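/- Let $(\Omega,\mathcal F,\mathbb P)$ be a complete probability space, $\vartheta:\Omega\to\Omega$ a $\mathbb P$-preserving transformation, and $(X,d)$ a compact metric space with Borel $\sigma$-algebra $\mathcal B$. Let $\mathcal E\in\mathcal F\otimes\mathcal B$ have nonempty compact fibers $\mathcal E_\omega=\{x:(\omega,x)\in\mathcal E\}$, $\omega\in\Omega$. Let $T$ be a continuous bundle random dynamical system on $\mathcal E$ over $(\Omega,\mathcal F,\mathbb P,\vartheta)$, i.e. a family of maps $T_\omega:\mathcal E_\omega\to\mathcal E_{\vartheta\omega}$ such that $(\omega,x)\mapsto T_\omega x$ is measurable on $\mathcal E$ and $T_\omega$ is continuous for $\mathbb P$-almost all $\omega$. Put $T^0_\omega=\mathrm{id}$ and $T^n_\omega=T_{\vartheta^{n-1}\omega}\circ\cdots\circ T_\omega$. *Entropy.* For $\epsilon>0$ and $n\ge1$ let $\mathrm{sep}(\omega,\epsilon,n)$ be the maximal cardinality of a set $F\subset\mathcal E_\omega$ such that $\max_{0\le k<n} d(T^k_\omega x,T^k_\omega y)\ge\epsilon$ for all $x\ne y$ in $F$. The topological entropy of $T$ is $$h_{\mathrm{top}}(T)=\int_\Omega\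 \lim_{\epsilon\to0}\ \limsup_{n\to\infty}\frac1n\log \mathrm{sep}(\omega,\epsilon,n)\ d\mathbb P(\omega)\in[0,\infty].$$ *Mean dimension.* For a finite open cover $\gamma$ of a nonempty compact space $K$ let $\mathrm{ord}(\gamma)=-1+\sup_{x\in K}\sum_{U\in\gamma}1_U(x)$ and $\mathcal D(\gamma)=\min_\beta \mathrm{ord}(\beta)$, where $\beta$ runs over all finite open covers of $K$ refining $\gamma$. For a finite open cover $\alpha$ of $X$ let $\alpha_0^{n-1}(\omega|\mathcal E)$ be the cover of $\mathcal E_\omega$ consisting of the sets $\bigcap_{i=0}^{n-1}(T^i_\omega)^{-1}(A_i\cap\mathcal E_{\vartheta^i\omega})$ with $A_0,\dots,A_{n-1}\in\alpha$; for $\mathbb P$-almost all $\omega$ these sets are open in $\mathcal E_\omega$ for every $n$. The mean topological dimension of $T$ is $$\mathrm{mdim}(T)=\sup_\alpha\ \lim_{n\to\infty}\frac1n\int_\Omega \mathcal D\big(\alpha_0^{n-1}(\omega|\mathcal E)\big)\,d\mathbb P(\omega),$$ the supremum being over all finite open covers $\alpha$ of $X$. **Corollary.** If $h_{\mathrm{top}}(T)<\infty$,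 then $\mathrm{mdim}(T)=0$. -/

import Mathlib

open Filter Topology MeasureTheory
open scoped ENNReal

noncomputable section

/-! ### Finite open covers, their order, and the invariant `𝒟` -/

/-- `α` is a finite open cover of the topological space `Y`. -/
def IsFiniteOpenCover {Y : Type*} [TopologicalSpace Y] (α : Set (Set Y)) : Prop :=
  α.Finite ∧ (∀ U ∈ α, IsOpen U) ∧ ⋃₀ α = Set.univ

/-- `β ≻ α`: every member of `β` is contained in some member of `α`. -/
def CoverRefines {Y : Type*} (β α : Set (Set Y)) : Prop :=
  ∀ B ∈ β, ∃ A ∈ α, B ⊆ A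

/-- `ord(α) = -1 + sup_x ∑_{U ∈ α} 1_U(x)`. For a cover of a nonempty space the supremum is at
least `1`, so the subtraction in `ℕ∞` is never truncated. -/
def coverOrd {Y : Type*} (α : Set (Set Y)) : ℕ∞ :=
  (⨆ x : Y, {U ∈ α | x ∈ U}.encard) - 1

/-- `𝒟(α) = min ord(β)` over the finite open covers `β` of `Y` that refine `α`. -/
def coverD {Y : Type*} [TopologicalSpace Y] (α : Set (Set Y)) : ℕ∞ :=
  ⨅ (β : Set (Set Y)) (_ : IsFiniteOpenCover β) (_ : CoverRefines β α), coverOrd β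

/-! ### Continuous bundle random dynamical systems -/

/-- A continuous bundle random dynamical system over `(Ω, P, ϑ)` with state space `X`.
The maps `T_ω : E_ω → E_{ϑω}` are given by a function `Ω → X → X`; its values off the bundle `E`
are unconstrained, and no notion below depends on them. -/
structure BundleRDS (Ω X : Type*) [MeasurableSpace Ω] (P : Measure Ω)
    [MetricSpace X] [MeasurableSpace X] where
  /-- the transformation `ϑ` of the base -/
  base : Ω → Ω
  base_measurePreserving : MeasurePreserving base P P
  /-- the bundle `E ⊆ Ω × X` -/
  bundle : Set (Ω × X)
  measurableSet_bundle : MeasurableSet bundle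
  fiber_nonempty : ∀ ω, {x | (ω, x) ∈ bundle}.Nonempty
  fiber_isCompact : ∀ ω, IsCompact {x | (ω, x) ∈ bundle}
  /-- the maps `T_ω` -/
  map : Ω → X → X
  map_mem : ∀ ω x, (ω, x) ∈ bundle → (base ω, map ω x) ∈ bundle
  measurable_map : Measurable fun p : bundle => map p.1.1 p.1.2
  continuousOn_map : ∀ᵐ ω ∂P, ContinuousOn (map ω) {x | (ω, x) ∈ bundle}

namespace BundleRDS

variable {Ω X : Type*} [MeasurableSpace Ω] {P : Measure Ω} [MetricSpace X] [MeasurableSpace X]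

/-- The fiber `E_ω`. -/
def fiber (T : BundleRDS Ω X P) (ω : Ω) : Set X :=
  {x | (ω, x) ∈ T.bundle}

/-- `T_ω^n = T_{ϑ^{n-1}ω} ∘ ⋯ ∘ T_{ϑω} ∘ T_ω`, with `T_ω^0 = id`. -/
def iter (T : BundleRDS Ω X P) : ℕ → Ω → X → X
  | 0, _, x => x
  | n + 1, ω, x => T.map (T.base^[n] ω) (T.iter n ω x)

/-! ### Mean topological dimension -/

/-- The cover `α_0^{n-1}(ω | E)` of the fiber `E_ω`, formed by the sets
`⋂_{i < n} (T_ω^i)⁻¹ (A_i ∩ E_{ϑ^i ω})` with `A_0, …, A_{n-1} ∈ α`. Points of `E_ω` are mapped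
into `E_{ϑ^i ω}` by `T_ω^i`, so the intersection with that fiber need not be written. -/
def iterCover (T : BundleRDS Ω X P) (α : Set (Set X)) (n : ℕ) (ω : Ω) :
    Set (Set (T.fiber ω)) :=
  Set.range fun j : Fin n → α => {x : T.fiber ω | ∀ i : Fin n, T.iter i ω x ∈ (j i : Set X)}

/-- `mdim(T, α) = lim_n (1/n) 𝔼 𝒟(α_0^{n-1}(ω | E))`. The limit exists, by subadditivity;
it is written as an upper limit. -/
def mdimCover (T : BundleRDS Ω X P) (α : Set (Set X)) : ℝ≥0∞ :=
  limsup (fun n : ℕ => (∫⁻ ω, ((coverD (T.iterCover α n ω) : ℕ∞) : ℝ≥0∞) ∂P) / n) atTop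

/-- The mean topological dimension: the supremum of `mdim(T, α)` over finite open covers `α`
of `X`. -/
def mdim (T : BundleRDS Ω X P) : ℝ≥0∞ :=
  ⨆ (α : Set (Set X)) (_ : IsFiniteOpenCover α), T.mdimCover α

/-! ### Topological entropy -/

/-- `d^ω_{ε,n}(x, y) = max_{0 ≤ k < n} d(T_ω^k x, T_ω^k y) / ε(ϑ^k ω)`. -/
def bowenDist (T : BundleRDS Ω X P) (ε : Ω → ℝ) (n : ℕ) (ω : Ω) (x y : X) : ℝ :=
  ⨆ k : Fin n, dist (T.iter k ω x) (T.iter k ω y) / ε (T.base^[k] ω)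

/-- `sep(ω, ε, n)`: the largest cardinality of a set `F ⊆ E_ω` whose distinct points are at
`d^ω_{ε,n}`-distance at least `1`. -/
def sep (T : BundleRDS Ω X P) (ε : Ω → ℝ) (n : ℕ) (ω : Ω) : ℕ∞ :=
  ⨆ (F : Set X) (_ : F ⊆ T.fiber ω)
    (_ : ∀ x ∈ F, ∀ y ∈ F, x ≠ y → 1 ≤ T.bowenDist ε n ω x y), F.encard

/-- `S'(ω, ε) = limsup_n (1/n) log sep(ω, ε, n)`. Fibers are nonempty, so `sep ≥ 1` and the
logarithm is nonnegative. -/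
def sepGrowth (T : BundleRDS Ω X P) (ε : Ω → ℝ) (ω : Ω) : ℝ≥0∞ :=
  limsup (fun n : ℕ => (ENNReal.log ((T.sep ε n ω : ℕ∞) : ℝ≥0∞)).toENNReal / n) atTop

/-- The topological entropy `h_top(T) = 𝔼 lim_{ε → 0} S'(ω, ε)`, over constants `ε > 0`. The
limit exists since `S'(ω, ε)` increases as `ε` decreases; it is written as an upper limit. -/
def topEntropy (T : BundleRDS Ω X P) : ℝ≥0∞ :=
  ∫⁻ ω, limsup (fun ε : ℝ => T.sepGrowth (fun _ => ε) ω) (𝓝[>] (0 : ℝ)) ∂P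

end BundleRDS

end

/-! Take a Lebesgue number `δ` of `α` and a finite `δ / 4`-net `s`. Choosing between below and above
a threshold in `(δ / 4, δ)` for each function `dist (T.iter i ω x) z`, `i < n`, `z ∈ s`, refines the
iterated cover, and the order is at most the number `K` of functions that can be near their
thresholds at one point. Good thresholds come from counting. With `L` possible values, a fixed point
has more than `K` near coordinates for only a fraction `2 ^ (n * s.card) / L ^ (K + 1)` of the
choices, and an `ε`-spanning set reduces the test to `N` points. Finite entropy gives `N ≤ 3 ^ (C *
n)` with `C` independent of `ε`, while `L` grows like `δ / ε`; so `K` can be any small fraction of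
`n`. Hence `𝒟 / n → 0` almost everywhere, and domination by `s.card` carries this to the integrals.
-/

/-- If at most `K` of the finitely many continuous functions `w c` are `η`-close to their
thresholds `ξ c` at any given point, then there is a finite open cover of order at most `K` on each
of whose members every `w c` stays either below `ξ c + η` or above `ξ c - η`. -/
theorem exists_cover_of_thresholds {Y ι : Type*} [TopologicalSpace Y] [Finite ι]
    (w : ι → Y → ℝ) (hw : ∀ c, Continuous (w c)) (ξ : ι → ℝ) {η : ℝ} (hη : 0 < η) (K : ℕ)
    (h : ∀ y, {c | |w c y - ξ c| < η}.ncard ≤ K) :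
    ∃ β : Set (Set Y), IsFiniteOpenCover β ∧ coverOrd β ≤ K ∧
      ∀ B ∈ β, ∀ c, (∀ y ∈ B, w c y < ξ c + η) ∨ (∀ y ∈ B, ξ c - η < w c y) := by
  classical
  -- `S` collects the coordinates closest to their thresholds, and `s` records the signs of the
  -- others.
  let O : Set ι → Set ι → Set Y := fun S s =>
    {y | ∀ c, (c ∈ S → |w c y - ξ c| < η ∧ ∀ c', c' ∉ S → |w c y - ξ c| < |w c' y - ξ c'|) ∧
      (c ∉ S → (c ∈ s → 0 < w c y - ξ c) ∧ (c ∉ s → w c y - ξ c < 0))}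
  let β : Set (Set Y) := (fun p : Set ι × Set ι => O p.1 p.2) '' {p | p.1.ncard ≤ K}
  have hβ : ∀ U ∈ β, ∃ S s, S.ncard ≤ K ∧ O S s = U := by
    rintro U ⟨⟨S, s⟩, hS, rfl⟩
    exact ⟨S, s, hS, rfl⟩
  refine ⟨β, ⟨(Set.toFinite _).image _, ?_, ?_⟩, ?_, ?_⟩
  · rintro U hU
    obtain ⟨S, s, -, rfl⟩ := hβ U hU
    simp only [O, Set.ofPred_forall, Set.ofPred_and]
    have hc : ∀ c, Continuous fun y => w c y - ξ c := fun c => (hw c).sub continuous_const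
    refine isOpen_iInter_of_finite fun c => IsOpen.inter ?_ ?_
    · refine isOpen_iInter_of_finite fun _ => IsOpen.inter
        (isOpen_lt (hc c).abs continuous_const) ?_
      exact isOpen_iInter_of_finite fun c' => isOpen_iInter_of_finite fun _ =>
        isOpen_lt (hc c).abs (hc c').abs
    · exact isOpen_iInter_of_finite fun _ => IsOpen.inter
        (isOpen_iInter_of_finite fun _ => isOpen_lt continuous_const (hc c))
        (isOpen_iInter_of_finite fun _ => isOpen_lt (hc c) continuous_const)
  · refine Set.eq_univ_of_forall fun y => ?_
    refine ⟨O {c | |w c y - ξ c| < η} {c | 0 < w c y - ξ c}, ⟨(_, _), h y, rfl⟩, fun c => ⟨?_, ?_⟩⟩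
    · intro hc
      refine ⟨hc, fun c' hc' => lt_of_lt_of_le hc (not_lt.mp hc')⟩
    · intro hc
      refine ⟨id, fun hs => ?_⟩
      have h1 : η ≤ |w c y - ξ c| := not_lt.mp hc
      have h2 : w c y - ξ c ≤ 0 := not_lt.mp hs
      rw [abs_of_nonpos h2] at h1
      linarith
  · refine tsub_le_iff_right.mpr (iSup_le fun y => ?_)
    choose! S s hS hO using hβ
    -- At `y`, the size of `S` determines `S` (the smallest gaps) and the signs off `S`, hence the
    -- member. Sizes `0, …, K` give `K + 1` members, so order `K`.
    have hle : {U ∈ β | y ∈ U}.encard ≤ (Set.Iic K).encard := by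
      refine Set.encard_le_encard_of_injOn (f := fun U => (S U).ncard)
        (fun U hU => hS U hU.1) ?_
      rintro U ⟨hU, hyU⟩ V ⟨hV, hyV⟩ hUV
      have hyU' := hyU
      have hyV' := hyV
      rw [← hO U hU] at hyU'
      rw [← hO V hV] at hyV'
      have hSS : S U = S V := by
        by_contra hne
        have h1 : ¬ S U ⊆ S V := fun hs =>
          hne (Set.eq_of_subset_of_ncard_le hs hUV.ge (Set.toFinite _))
        have h2 : ¬ S V ⊆ S U := fun hs =>
          hne (Set.eq_of_subset_of_ncard_le hs hUV.le (Set.toFinite _)).symm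
        obtain ⟨c, hc, hc'⟩ := Set.not_subset.mp h1
        obtain ⟨d, hd, hd'⟩ := Set.not_subset.mp h2
        exact lt_asymm (((hyU' c).1 hc).2 d hd') (((hyV' d).1 hd).2 c hc')
      have hss : ∀ c ∉ S U, (c ∈ s U ↔ c ∈ s V) := by
        intro c hc
        have h1 := (hyU' c).2 hc
        have h2 := (hyV' c).2 (hSS ▸ hc)
        constructor
        · intro h3
          by_contra h4
          exact lt_asymm (h1.1 h3) (h2.2 h4)
        · intro h3
          by_contra h4
          exact lt_asymm (h2.1 h3) (h1.2 h4)
      rw [← hO U hU, ← hO V hV]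
      ext z
      refine forall_congr' fun c => ?_
      rw [← hSS]
      refine and_congr_right fun _ => forall_congr' fun hc => ?_
      rw [hss c hc]
    refine hle.trans ?_
    rw [Set.encard_eq_coe_toFinset_card]
    simp
  · intro B hB c
    obtain ⟨S, s, -, rfl⟩ := hβ B hB
    by_cases hc : c ∈ S
    · left
      intro y hy
      have := (abs_lt.mp ((hy c).1 hc).1).2
      linarith
    · by_cases hs : c ∈ s
      · right
        intro y hy
        have := ((hy c).2 hc).1 hs
        linarith
      · left
        intro y hy
        have := ((hy c).2 hc).2 hs
        linarith

/-- Counting argument: thresholds can be chosen on a grid of `L` values so that each of a given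
finite family of vectors has at most `K` coordinates that are close to the threshold. -/
theorem exists_thresholds_of_card_lt {κ ι : Type*} [Fintype ι] (F : Finset κ) (v : κ → ι → ℝ)
    {L K : ℕ} (t : Fin L → ℝ) {r : ℝ} (ht : ∀ a b, a ≠ b → 2 * r ≤ |t a - t b|)
    (hcard : F.card * 2 ^ Fintype.card ι < L ^ (K + 1)) :
    ∃ ξ : ι → Fin L, ∀ y ∈ F, {c | |v y c - t (ξ c)| < r}.ncard ≤ K := by
  classical
  have hL : 0 < L := by
    rcases Nat.eq_zero_or_pos L with rfl | h
    · simp at hcard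
    · exact h
  by_cases hK : Fintype.card ι ≤ K
  · refine ⟨fun _ => ⟨0, hL⟩, fun y _ => le_trans ?_ hK⟩
    rw [← Nat.card_eq_fintype_card, ← Set.ncard_univ]
    exact Set.ncard_le_ncard (Set.subset_univ _) (Set.toFinite _)
  push Not at hK
  by_contra! hcon
  -- The choices near `v y` on all of `S`. The windows of radius `r` are disjoint, so each
  -- coordinate in `S` allows at most one grid value.
  let near : κ → Finset ι → Finset (ι → Fin L) := fun y S =>
    Fintype.piFinset fun c => if c ∈ S then Finset.univ.filter fun a => |v y c - t a| < r
      else Finset.univ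
  have hnear : ∀ y S, S.card = K + 1 → (near y S).card ≤ L ^ (Fintype.card ι - (K + 1)) := by
    intro y S hS
    rw [Fintype.card_piFinset]
    calc _ ≤ ∏ c : ι, (if c ∈ S then 1 else L) := by
          refine Finset.prod_le_prod' fun c _ => ?_
          split_ifs with hc
          · refine Finset.card_le_one.mpr fun a ha b hb => ?_
            by_contra hab
            have h1 := ht a b hab
            simp only [Finset.mem_filter, Finset.mem_univ, true_and] at ha hb
            have h2 : |t a - t b| ≤ |v y c - t b| + |v y c - t a| := by
              have := abs_sub (v y c - t b) (v y c - t a)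
              rwa [sub_sub_sub_cancel_left] at this
            linarith
          · simp
      _ = L ^ (Fintype.card ι - (K + 1)) := by
          rw [Finset.prod_ite]
          simp only [Finset.prod_const, one_pow, one_mul]
          rw [Finset.filter_not, Finset.filter_mem_eq_inter, Finset.univ_inter,
            ← Finset.compl_eq_univ_sdiff, Finset.card_compl, hS]
  have hsub : (Finset.univ : Finset (ι → Fin L)) ⊆
      F.biUnion fun y => (Finset.univ.powersetCard (K + 1)).biUnion fun S => near y S := by
    intro ξ _
    obtain ⟨y, hy, hξ⟩ := hcon ξ
    rw [Set.ncard_eq_toFinset_card'] at hξ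
    obtain ⟨S, hS, hSc⟩ := Finset.exists_subset_card_eq (Nat.succ_le_of_lt hξ)
    simp only [Finset.mem_biUnion, Finset.mem_powersetCard, Finset.subset_univ, true_and]
    refine ⟨y, hy, S, hSc, Fintype.mem_piFinset.mpr fun c => ?_⟩
    split_ifs with hc
    · simpa using hS hc
    · exact Finset.mem_univ _
  have hle : L ^ Fintype.card ι ≤
      F.card * (2 ^ Fintype.card ι * L ^ (Fintype.card ι - (K + 1))) := by
    calc L ^ Fintype.card ι = (Finset.univ : Finset (ι → Fin L)).card := by simp
      _ ≤ _ := Finset.card_le_card hsub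
      _ ≤ _ := by
        refine Finset.card_biUnion_le_card_mul _ _ _ fun y _ => ?_
        refine (Finset.card_biUnion_le_card_mul _ _ (L ^ (Fintype.card ι - (K + 1)))
          fun S hS => hnear y S (Finset.mem_powersetCard.mp hS).2).trans ?_
        gcongr
        rw [Finset.card_powersetCard, Finset.card_univ]
        exact Nat.choose_le_two_pow _ _
  have hlt : F.card * 2 ^ Fintype.card ι * L ^ (Fintype.card ι - (K + 1)) <
      L ^ (K + 1) * L ^ (Fintype.card ι - (K + 1)) :=
    Nat.mul_lt_mul_of_pos_right hcard (pow_pos hL _)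
  rw [← pow_add, Nat.add_sub_cancel' hK] at hlt
  rw [← mul_assoc] at hle
  exact absurd hle (not_le.mpr hlt)

/-! ### Fiberwise estimates: separated sets and the order of iterated covers -/

namespace BundleRDS

variable {Ω X : Type*} [MeasurableSpace Ω] {P : Measure Ω} [MetricSpace X] [MeasurableSpace X]

theorem iter_mem_fiber (T : BundleRDS Ω X P) (n : ℕ) {ω : Ω} {x : X} (hx : x ∈ T.fiber ω) :
    T.iter n ω x ∈ T.fiber (T.base^[n] ω) := by
  induction n with
  | zero => exact hx
  | succ n ih =>
    rw [Function.iterate_succ_apply']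
    exact T.map_mem _ _ ih

theorem ae_continuousOn_iter (T : BundleRDS Ω X P) :
    ∀ᵐ ω ∂P, ∀ n, ContinuousOn (T.iter n ω) (T.fiber ω) := by
  have h : ∀ᵐ ω ∂P, ∀ n, ContinuousOn (T.map (T.base^[n] ω)) (T.fiber (T.base^[n] ω)) :=
    ae_all_iff.mpr fun n =>
      (T.base_measurePreserving.iterate n).quasiMeasurePreserving.ae T.continuousOn_map
  filter_upwards [h] with ω hω n
  induction n with
  | zero => exact continuousOn_id
  | succ n ih => exact (hω n).comp ih fun x hx => T.iter_mem_fiber n hx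

/-- A maximal separated set is a finite spanning set. -/
theorem exists_spanning_of_sep_ne_top (T : BundleRDS Ω X P) {ε : ℝ} (hε : 0 < ε) (n : ℕ) (ω : Ω)
    (hsep : T.sep (fun _ => ε) n ω ≠ ⊤) :
    ∃ F : Finset X, (F.card : ℕ∞) ≤ T.sep (fun _ => ε) n ω ∧
      ∀ x ∈ T.fiber ω, ∃ y ∈ F, ∀ k < n, dist (T.iter k ω x) (T.iter k ω y) < ε := by
  classical
  let Sep : Set X → Prop := fun F => F ⊆ T.fiber ω ∧
    ∀ x ∈ F, ∀ y ∈ F, x ≠ y → 1 ≤ T.bowenDist (fun _ => ε) n ω x y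
  have hsup : ∀ F, Sep F → F.encard ≤ T.sep (fun _ => ε) n ω := fun F hF =>
    le_iSup_of_le F (le_iSup_of_le hF.1 (le_iSup_of_le hF.2 le_rfl))
  have heq : T.sep (fun _ => ε) n ω = ⨆ F : {F // Sep F}, F.1.encard := by
    refine le_antisymm (iSup_le fun F => iSup_le fun h1 => iSup_le fun h2 => ?_)
      (iSup_le fun F => hsup F.1 F.2)
    exact le_iSup (fun F : {F // Sep F} => F.1.encard) ⟨F, h1, h2⟩
  have : Nonempty {F // Sep F} := ⟨⟨∅, by simp [Sep]⟩⟩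
  obtain ⟨⟨F, hF⟩, hFmax⟩ := ENat.exists_eq_iSup_of_lt_top (heq ▸ hsep.lt_top)
  rw [← heq] at hFmax
  have hFfin : F.Finite := by
    rw [← Set.encard_ne_top_iff]
    exact fun h => hsep (hFmax ▸ h)
  refine ⟨hFfin.toFinset, ?_, fun x hx => ?_⟩
  · rw [← hFmax, hFfin.encard_eq_coe_toFinset_card]
  by_cases hxF : x ∈ F
  · exact ⟨x, by simpa using hxF, fun k _ => by simpa using hε⟩
  have hcomm : ∀ a b, T.bowenDist (fun _ => ε) n ω a b = T.bowenDist (fun _ => ε) n ω b a :=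
    fun a b => by simp only [bowenDist, dist_comm]
  have hnot : ¬ Sep (insert x F) := by
    intro hS
    have h1 := hsup _ hS
    rw [Set.encard_insert_of_notMem hxF, ← hFmax, hFmax] at h1
    exact absurd h1 (not_le.mpr ((ENat.lt_add_one_iff hsep).mpr le_rfl))
  obtain ⟨y, hy, hxy⟩ : ∃ y ∈ F, T.bowenDist (fun _ => ε) n ω x y < 1 := by
    by_contra! hcon
    refine hnot ⟨Set.insert_subset hx hF.1, ?_⟩
    rintro a (rfl | ha) b (rfl | hb) hab
    · exact absurd rfl hab
    · exact hcon b hb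
    · exact hcomm _ _ ▸ hcon a ha
    · exact hF.2 a ha b hb hab
  refine ⟨y, by simpa using hy, fun k hk => ?_⟩
  have h1 := (le_ciSup (f := fun k : Fin n => dist (T.iter k ω x) (T.iter k ω y) / ε)
    (Set.finite_range _).bddAbove ⟨k, hk⟩).trans_lt hxy
  exact (div_lt_one hε).mp h1

/-- Thresholds for the distances to the points of a finite net bound `𝒟` of the iterated cover. -/
theorem coverD_iterCover_le_of_thresholds (T : BundleRDS Ω X P) {α : Set (Set X)} {δ : ℝ}
    (hδ : ∀ x, ∃ A ∈ α, Metric.ball x δ ⊆ A) (s : Finset X) (hs : ∀ x, ∃ z ∈ s, dist x z < δ / 4)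
    {ω : Ω} (hω : ∀ n, ContinuousOn (T.iter n ω) (T.fiber ω)) (n K : ℕ) {ε : ℝ} (hε : 0 < ε)
    (ξ : Fin n × s → ℝ) (hξ : ∀ c, δ / 4 + ε ≤ ξ c ∧ ξ c + ε ≤ δ)
    (hK : ∀ x ∈ T.fiber ω, {c | |dist (T.iter c.1 ω x) c.2 - ξ c| < ε}.ncard ≤ K) :
    coverD (T.iterCover α n ω) ≤ K := by
  obtain ⟨β, hβ, hord, hsep⟩ := exists_cover_of_thresholds
    (fun (c : Fin n × s) (x : T.fiber ω) => dist (T.iter c.1 ω x) c.2)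
    (fun c => (continuousOn_iff_continuous_domRestrict.mp (hω c.1)).dist continuous_const) ξ hε K
    fun y => hK y y.2
  refine iInf_le_of_le β (iInf_le_of_le hβ (iInf_le_of_le ?_ hord))
  intro B hB
  have hA : ∀ i : Fin n, ∃ A : α, ∀ y ∈ B, T.iter i ω y ∈ (A : Set X) := by
    intro i
    rcases B.eq_empty_or_nonempty with rfl | ⟨y₀, hy₀⟩
    · obtain ⟨y, hy⟩ := T.fiber_nonempty ω
      obtain ⟨A, hA, -⟩ := hδ y
      exact ⟨⟨A, hA⟩, by simp⟩
    · obtain ⟨z, hz, hz'⟩ := hs (T.iter i ω y₀)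
      obtain ⟨A, hA, hAz⟩ := hδ z
      refine ⟨⟨A, hA⟩, fun y hy => hAz ?_⟩
      -- The net point `z` is within `δ / 4` of the image of `y₀`, which rules out the upper side.
      rcases hsep B hB (i, ⟨z, hz⟩) with h | h
      · exact (h y hy).trans_le (hξ _).2
      · have h1 := h y₀ hy₀
        have h2 := (hξ (i, ⟨z, hz⟩)).1
        simp only at h1
        linarith
  choose j hj using hA
  exact ⟨_, ⟨j, rfl⟩, fun y hy i => hj i y hy⟩

/-- Allowing every coordinate to be near its threshold makes the counting unnecessary; this gives
the dominating constant for the reverse Fatou step. -/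
theorem coverD_iterCover_le_mul (T : BundleRDS Ω X P) {α : Set (Set X)} {δ : ℝ} (hδ0 : 0 < δ)
    (hδ : ∀ x, ∃ A ∈ α, Metric.ball x δ ⊆ A) (s : Finset X) (hs : ∀ x, ∃ z ∈ s, dist x z < δ / 4)
    {ω : Ω} (hω : ∀ n, ContinuousOn (T.iter n ω) (T.fiber ω)) (n : ℕ) :
    coverD (T.iterCover α n ω) ≤ (n * s.card : ℕ) := by
  refine T.coverD_iterCover_le_of_thresholds hδ s hs hω n _ (ε := δ / 4) (by linarith)
    (fun _ => δ / 2) (fun _ => ⟨by linarith, by linarith⟩) fun x _ => ?_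
  refine (Set.ncard_le_ncard (Set.subset_univ _) (Set.toFinite _)).trans ?_
  simp [Set.ncard_univ]

/-- `𝒟` of the iterated cover is controlled by the number of separated points. -/
theorem coverD_iterCover_le_of_sep (T : BundleRDS Ω X P) {α : Set (Set X)} {δ : ℝ}
    (hδ : ∀ x, ∃ A ∈ α, Metric.ball x δ ⊆ A) (s : Finset X) (hs : ∀ x, ∃ z ∈ s, dist x z < δ / 4)
    {ω : Ω} (hω : ∀ n, ContinuousOn (T.iter n ω) (T.fiber ω)) {n K L N : ℕ} {ε : ℝ} (hε : 0 < ε)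
    (hL : 8 * ε * L ≤ δ) (hN : T.sep (fun _ => ε) n ω ≤ N)
    (hcard : N * 2 ^ (n * s.card) < L ^ (K + 1)) :
    coverD (T.iterCover α n ω) ≤ K := by
  obtain ⟨F, hF, hspan⟩ := T.exists_spanning_of_sep_ne_top hε n ω
    (ne_top_of_le_ne_top (ENat.natCast_ne_top N) hN)
  have hFN : F.card ≤ N := by exact_mod_cast hF.trans hN
  -- Spacing `4 * ε` keeps windows of radius `2 * ε` disjoint: passing from `x` to a spanning point
  -- costs one extra `ε`.
  let t : Fin L → ℝ := fun a => δ / 4 + ε + 4 * ε * (a : ℕ)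
  have ht : ∀ a b, a ≠ b → 2 * (2 * ε) ≤ |t a - t b| := by
    intro a b hab
    have h1 : t a - t b = 4 * ε * (((a : ℕ) : ℤ) - ((b : ℕ) : ℤ) : ℤ) := by
      simp only [t]
      push_cast
      ring
    have h2 : (1 : ℤ) ≤ |((a : ℕ) : ℤ) - ((b : ℕ) : ℤ)| := by
      refine Int.one_le_abs fun h => hab (Fin.ext ?_)
      omega
    have h3 : (1 : ℝ) ≤ |((((a : ℕ) : ℤ) - ((b : ℕ) : ℤ) : ℤ) : ℝ)| := by exact_mod_cast h2
    rw [h1, abs_mul, abs_of_pos (by positivity)]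
    nlinarith
  obtain ⟨ξ, hξ⟩ := exists_thresholds_of_card_lt (ι := Fin n × s) F
    (fun y c => dist (T.iter c.1 ω y) c.2) t ht (K := K)
    (lt_of_le_of_lt (by simp only [Fintype.card_prod, Fintype.card_fin, Fintype.card_coe]; gcongr)
      hcard)
  refine T.coverD_iterCover_le_of_thresholds hδ s hs hω n K hε (fun c => t (ξ c))
    (fun c => ⟨?_, ?_⟩) fun x hx => ?_
  · simp only [t]
    have : 0 ≤ 4 * ε * ((ξ c : ℕ) : ℝ) := by positivity
    linarith
  · have h1 : ((ξ c : ℕ) : ℝ) + 1 ≤ L := by exact_mod_cast (ξ c).2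
    simp only [t]
    nlinarith [mul_le_mul_of_nonneg_left h1 hε.le, (Nat.cast_nonneg (ξ c : ℕ) : (0 : ℝ) ≤ _)]
  · obtain ⟨y, hy, hxy⟩ := hspan x hx
    refine le_trans (Set.ncard_le_ncard (fun c hc => ?_) (Set.toFinite _)) (hξ y hy)
    have h1 := hxy c.1 c.1.2
    have h2 : |dist (T.iter c.1 ω x) c.2 - t (ξ c)| < ε := hc
    have h3 := abs_dist_sub_le (T.iter c.1 ω x) (T.iter c.1 ω y) (c.2 : X)
    change |dist (T.iter c.1 ω y) c.2 - t (ξ c)| < 2 * ε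
    rw [abs_lt] at h2 ⊢
    rw [abs_le] at h3
    constructor <;> linarith

theorem sep_le_pow_of_log_lt (T : BundleRDS Ω X P) {ε : Ω → ℝ} {n C : ℕ} {ω : Ω} (hn : n ≠ 0)
    (h : (ENNReal.log ((T.sep ε n ω : ℕ∞) : ℝ≥0∞)).toENNReal / n < C) :
    T.sep ε n ω ≤ (3 ^ (C * n) : ℕ) := by
  have h1 : (ENNReal.log ((T.sep ε n ω : ℕ∞) : ℝ≥0∞)).toENNReal ≤ (C * n : ℕ) := by
    have := (ENNReal.div_le_iff (by simpa using hn) (by simp)).mp h.le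
    simpa using this
  have h2 : ENNReal.log ((T.sep ε n ω : ℕ∞) : ℝ≥0∞) ≤ (((C * n : ℕ) : ℝ) : EReal) := by
    refine (EReal.coe_toENNReal_eq_max.ge.trans' (le_max_right _ _)).trans ?_
    refine (EReal.coe_ennreal_le_coe_ennreal_iff.mpr h1).trans_eq ?_
    rw [← ENNReal.ofReal_natCast, EReal.coe_ennreal_ofReal, max_eq_left (Nat.cast_nonneg _)]
  have h3 := EReal.exp_monotone h2
  rw [ENNReal.exp_log, EReal.exp_coe] at h3
  have h4 : Real.exp ((C * n : ℕ) : ℝ) ≤ ((3 ^ (C * n) : ℕ) : ℝ) := by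
    rw [← mul_one ((C * n : ℕ) : ℝ), Real.exp_nat_mul]
    push_cast
    gcongr
    exact Real.exp_one_lt_three.le
  have h5 := h3.trans (ENNReal.ofReal_le_ofReal h4)
  rw [ENNReal.ofReal_natCast] at h5
  exact_mod_cast h5

theorem limsup_coverD_eq_zero (T : BundleRDS Ω X P) {α : Set (Set X)} {δ : ℝ} (hδ0 : 0 < δ)
    (hδ : ∀ x, ∃ A ∈ α, Metric.ball x δ ⊆ A) (s : Finset X) (hs : ∀ x, ∃ z ∈ s, dist x z < δ / 4)
    {ω : Ω} (hω : ∀ n, ContinuousOn (T.iter n ω) (T.fiber ω))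
    (hfin : limsup (fun ε : ℝ => T.sepGrowth (fun _ => ε) ω) (𝓝[>] (0 : ℝ)) ≠ ⊤) :
    limsup (fun n : ℕ => ((coverD (T.iterCover α n ω) : ℕ∞) : ℝ≥0∞) / n) atTop = 0 := by
  obtain ⟨C, hC⟩ := ENNReal.exists_nat_gt hfin
  have key : ∀ q : ℕ, 0 < q → ∀ᶠ n : ℕ in atTop, coverD (T.iterCover α n ω) ≤ (n / q : ℕ) := by
    intro q hq
    -- `B ^ n` bounds the count `N * 2 ^ (n * s.card)`, so `L = B ^ q` and `K = n / q` suffice. As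
    -- `C` is fixed before `ε`, `ε` may be shrunk to fit `B ^ q` grid values.
    obtain ⟨B, hB⟩ : ∃ B : ℕ, B = 3 ^ (C + 1) * 2 ^ s.card := ⟨_, rfl⟩
    have hB1 : 1 < B := by
      have h1 : 1 < 3 ^ (C + 1) := Nat.one_lt_pow (by omega) (by omega)
      exact hB ▸ h1.trans_le (Nat.le_mul_of_pos_right _ (by positivity))
    have hsmall : ∀ᶠ ε : ℝ in 𝓝[>] 0, ε ≤ δ / (8 * (B ^ q : ℕ)) := by
      refine nhdsWithin_le_nhds (Iic_mem_nhds ?_)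
      positivity
    have hpos : ∀ᶠ ε : ℝ in 𝓝[>] 0, 0 < ε := self_mem_nhdsWithin
    obtain ⟨ε, hεC, hεδ, hε⟩ := ((eventually_lt_of_limsup_lt hC).and (hsmall.and hpos)).exists
    filter_upwards [eventually_lt_of_limsup_lt hεC, eventually_ge_atTop 1] with n hn hn1
    refine T.coverD_iterCover_le_of_sep hδ s hs hω hε (L := B ^ q) (N := 3 ^ (C * n)) ?_
      (T.sep_le_pow_of_log_lt (by omega) hn) ?_
    · rw [le_div_iff₀ (by positivity)] at hεδ
      linarith
    · calc 3 ^ (C * n) * 2 ^ (n * s.card) ≤ 3 ^ ((C + 1) * n) * 2 ^ (n * s.card) := by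
            gcongr <;> omega
        _ = B ^ n := by rw [hB, mul_pow, ← pow_mul, ← pow_mul, mul_comm n]
        _ < B ^ (q * (n / q + 1)) := Nat.pow_lt_pow_right hB1 (Nat.lt_mul_div_succ n hq)
        _ = (B ^ q) ^ (n / q + 1) := pow_mul _ _ _
  have hle : ∀ q : ℕ, limsup (fun n : ℕ => ((coverD (T.iterCover α n ω) : ℕ∞) : ℝ≥0∞) / n) atTop
      ≤ (((q + 1 : ℕ) : ℝ≥0∞))⁻¹ := by
    intro q
    refine limsup_le_of_le (h := ?_)
    filter_upwards [key (q + 1) q.succ_pos, eventually_ge_atTop 1] with n hn hn1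
    have h1 : ((coverD (T.iterCover α n ω) : ℕ∞) : ℝ≥0∞) ≤ ((n / (q + 1) : ℕ) : ℝ≥0∞) := by
      exact_mod_cast hn
    refine ENNReal.div_le_of_le_mul (h1.trans ?_)
    rw [mul_comm, ← div_eq_mul_inv,
      ENNReal.le_div_iff_mul_le (Or.inl (by simp)) (Or.inl (ENNReal.natCast_ne_top _))]
    exact_mod_cast Nat.div_mul_le_self n (q + 1)
  refine le_antisymm (ge_of_tendsto'
    (ENNReal.tendsto_inv_nat_nhds_zero.comp (tendsto_add_atTop_nat 1)) hle) bot_le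

end BundleRDS

/-! ### Integration over the base -/

/-- A reverse Fatou lemma for possibly nonmeasurable functions whose upper limit vanishes outside
the infinity set of a function with finite lower integral. -/
theorem limsup_lintegral_eq_zero_of_limsup_eq_zero {Ω : Type*} [MeasurableSpace Ω] {P : Measure Ω}
    [IsFiniteMeasure P] (g : ℕ → Ω → ℝ≥0∞) {h : Ω → ℝ≥0∞} (hh : ∫⁻ ω, h ω ∂P < ⊤) {M : ℝ≥0∞}
    (hM : M ≠ ⊤) (hgM : ∀ n, ∀ᵐ ω ∂P, g n ω ≤ M)
    (hg : ∀ᵐ ω ∂P, h ω ≠ ⊤ → limsup (fun n => g n ω) atTop = 0) :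
    limsup (fun n => ∫⁻ ω, g n ω ∂P) atTop = 0 := by
  -- Measurable minorants with the same lower integrals replace the `g n`.
  choose φ hφm hφg hφi using fun n => exists_measurable_le_lintegral_eq P (g n)
  simp only [hφi]
  have hmeas : Measurable fun ω => limsup (fun n => φ n ω) atTop := Measurable.limsup hφm
  have hset : MeasurableSet {ω | limsup (fun n => φ n ω) atTop ≠ 0} :=
    (hmeas (measurableSet_singleton 0)).compl
  -- Almost everywhere on this measurable set `h = ⊤`, so positive measure would make the integral
  -- of `h` infinite.
  have hzero : P {ω | limsup (fun n => φ n ω) atTop ≠ 0} = 0 := by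
    by_contra hne
    have h1 : ∫⁻ ω, {ω | limsup (fun n => φ n ω) atTop ≠ 0}.indicator (fun _ => ⊤) ω ∂P
        ≤ ∫⁻ ω, h ω ∂P := by
      refine lintegral_mono_ae ?_
      filter_upwards [hg] with ω hω
      refine Set.indicator_apply_le' (fun hmem => ?_) (fun _ => zero_le)
      by_contra hlt
      refine hmem (le_antisymm ?_ bot_le)
      rw [← hω fun htop => hlt htop.ge]
      exact limsup_le_limsup (Eventually.of_forall fun n => hφg n ω)
    rw [lintegral_indicator_const hset, ENNReal.top_mul hne] at h1
    exact absurd hh (not_lt.mpr h1)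
  refine le_antisymm ?_ bot_le
  calc limsup (fun n => ∫⁻ ω, φ n ω ∂P) atTop
      ≤ ∫⁻ ω, limsup (fun n => φ n ω) atTop ∂P := by
        refine limsup_lintegral_le (fun _ => M) hφm (fun n => ?_) ?_
        · filter_upwards [hgM n] with ω hω using (hφg n ω).trans hω
        · rw [lintegral_const]
          exact ENNReal.mul_ne_top hM (measure_ne_top _ _)
    _ = 0 := by
        rw [lintegral_eq_zero_iff hmeas]
        exact hzero

theorem mainTheorem3 {Ω X : Type*} [MeasurableSpace Ω] (P : Measure Ω) [IsProbabilityMeasure P]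
    [P.IsComplete] [MetricSpace X] [CompactSpace X] [MeasurableSpace X] [BorelSpace X]
    (T : BundleRDS Ω X P) (hT : T.topEntropy < ⊤) :
    T.mdim = 0 := by
  refine le_antisymm (iSup_le fun α => iSup_le fun hα => ?_) bot_le
  obtain ⟨δ, hδ0, hδ⟩ := lebesgue_number_lemma_of_metric_sUnion isCompact_univ hα.2.1 hα.2.2.ge
  replace hδ : ∀ x, ∃ A ∈ α, Metric.ball x δ ⊆ A := fun x => hδ x (Set.mem_univ x)
  obtain ⟨s, -, hs, hcov⟩ := finite_cover_balls_of_compact (isCompact_univ (X := X))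
    (show 0 < δ / 4 by linarith)
  lift s to Finset X using hs
  replace hs : ∀ x, ∃ z ∈ s, dist x z < δ / 4 := fun x => by simpa using hcov (Set.mem_univ x)
  have hlim := limsup_lintegral_eq_zero_of_limsup_eq_zero (P := P)
    (fun n ω => ((coverD (T.iterCover α n ω) : ℕ∞) : ℝ≥0∞) / n) hT
    (ENNReal.natCast_ne_top s.card) (fun n => ?_) ?_
  · rw [← hlim]
    refine limsup_le_limsup (Eventually.of_forall fun n => ?_)
    simp only [div_eq_mul_inv]
    exact lintegral_mul_const_le _ _
  · filter_upwards [T.ae_continuousOn_iter] with ω hω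
    have h1 : ((coverD (T.iterCover α n ω) : ℕ∞) : ℝ≥0∞) ≤ ((n * s.card : ℕ) : ℝ≥0∞) := by
      exact_mod_cast T.coverD_iterCover_le_mul hδ0 hδ s hs hω n
    refine ENNReal.div_le_of_le_mul (h1.trans_eq ?_)
    rw [mul_comm, Nat.cast_mul]
  · filter_upwards [T.ae_continuousOn_iter] with ω hω hfin
    exact T.limsup_coverD_eq_zero hδ0 hδ s hs hω hfin
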